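/- For a Borel measure $\mu$ on $\mathbb{R}^n$ (finite or infinite), let $$M(\mu)=\Big\{\int_{\mathbb{R}^n} y f(y)\,d\mu(y)\;:\; f:\mathbb{R}^n\to[0,1]\text{ measurable},\ \int_{\mathbb{R}^n} f\,d\mu=1,\ \int_{\mathbb{R}^n}|y|f(y)\,d\mu(y)<\infty\Big\}$$ be the metronoid generated by $\mu$. For a convex body $K\subseteq\mathbb{R}^n$ with the origin in its interior and gauge function $\|x\|_K=\inf\{t>0: x\in tK\}$, let $$\mathrm{vein}^*(K)=\inf\Big\{\int_{\mathbb{R}^n}\|x\|_K\,d\mu(x)\;:\;\mu\text{ a Borel measure on }\mathbb{R}^n,\ K\subseteq M(\mu)\Big\}$$ be its fractional vertex index. Let $B_2^n=\{x\in\mathbb{R}^n : |x|\le 1\}$ be the Euclidean unit ball. Proposition 4.2. There is a sequence of real numbers $\varepsilon_n\to 0$ such that, for every $n\ge 1$, $$\mathrm{vein}^*(B_2^n)=\sqrt{2\pi n}\,(1+\varepsilon_n).$$ In particular, $\mathrm{vein}^*(B_2^n)=\sqrt{2\pi n}\,(1+o(1))$ as $n\to\infty$. -/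

import Mathlib

open MeasureTheory
open scoped ENNReal

/-- The metronoid generated by a Borel measure `μ` on a real normed space: the set of all points
`∫ y f(y) dμ(y)`, where `f` ranges over the measurable functions with values in `[0,1]` and
`∫ f dμ = 1`. The equation `∫ f dμ = 1` forces `f` to be integrable; integrability of `y ↦ f(y) y`
is required so that the vector-valued integral is meaningful. -/
def metronoid {E : Type*} [NormedAddCommGroup E] [NormedSpace ℝ E] [MeasurableSpace E]
    (μ : Measure E) : Set E :=
  {x | ∃ f : E → ℝ, Measurable f ∧ (∀ y, 0 ≤ f y ∧ f y ≤ 1) ∧ ∫ y, f y ∂μ = 1 ∧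
    Integrable (fun y => f y • y) μ ∧ ∫ y, f y • y ∂μ = x}

/-- The fractional vertex index of a convex body `K` with the origin in its interior: the infimum
of the costs `∫ ‖x‖_K dμ(x)` over all Borel measures `μ` (finite or not) whose metronoid
contains `K`, where `‖·‖_K` is the gauge of `K`. The cost is a Lebesgue integral with values in
`[0,∞]`, so a measure without finite first moment has cost `∞`. -/
noncomputable def fracVertexIndex {E : Type*} [NormedAddCommGroup E] [NormedSpace ℝ E]
    [MeasurableSpace E] (K : Set E) : ℝ≥0∞ :=
  ⨅ (μ : Measure E) (_ : K ⊆ metronoid μ), ∫⁻ x, ENNReal.ofReal (gauge K x) ∂μ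

open ProbabilityTheory

/-! For a standard Gaussian vector `g`, the index of the ball is exactly `√(2π) E‖g‖`
(`fracVertexIndex_closedBall_eq`). Lower bound: if the ball lies in the metronoid of `μ`, every `g`
satisfies `2‖g‖ ≤ ∫ |⟪g, y⟫| dμ(y)`. Averaging over `g` turns the right side into `√(2/π) ∫ ‖y‖ dμ`,
since `E|⟪g, y⟫| = √(2/π) ‖y‖`. Upper bound: equality holds for a suitably scaled Gaussian of mass
2, whose half-spaces through the origin have mass 1 and barycentre on the unit sphere. Finally `E‖g‖
= √n (1 + O(1/n))`, from the second and fourth moments of `‖g‖`. -/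

theorem integral_abs_gaussianReal_zero_one :
    ∫ x, |x| ∂(gaussianReal 0 1) = Real.sqrt (2 / Real.pi) := by
  rw [integral_gaussianReal_eq_integral_smul one_ne_zero]
  have h1 : ∀ x : ℝ, gaussianPDFReal 0 1 x • |x| =
      (fun t : ℝ => (Real.sqrt (2 * Real.pi))⁻¹ * (t * Real.exp (-(1 / 2) * t ^ 2))) |x| := by
    intro x
    simp only [gaussianPDFReal, NNReal.coe_one, mul_one, sub_zero, smul_eq_mul, sq_abs]
    rw [show -x ^ 2 / 2 = -(1 / 2) * x ^ 2 by ring]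
    ring
  simp_rw [h1]
  rw [integral_comp_abs (f := fun t : ℝ => (Real.sqrt (2 * Real.pi))⁻¹ *
    (t * Real.exp (-(1 / 2) * t ^ 2))), integral_const_mul]
  have h2 := integral_rpow_mul_exp_neg_mul_rpow (p := 2) (q := 1) (b := 1 / 2)
    (by norm_num) (by norm_num) (by norm_num)
  have h3 : ∫ t in Set.Ioi (0 : ℝ), t * Real.exp (-(1 / 2) * t ^ 2) = 1 := by
    norm_num at h2
    norm_num
    exact h2
  rw [h3, Real.sqrt_div (by norm_num), Real.sqrt_mul (by norm_num)]
  have : 0 < Real.sqrt Real.pi := Real.sqrt_pos.2 Real.pi_pos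
  have h4 : Real.sqrt 2 * Real.sqrt 2 = 2 := Real.mul_self_sqrt (by norm_num)
  have : 0 < Real.sqrt 2 := by positivity
  field_simp
  nlinarith

/-! ### Gaussian integrals of linear functionals and their signs -/

section

variable {E : Type*} [NormedAddCommGroup E] [InnerProductSpace ℝ E] [FiniteDimensional ℝ E]
  [MeasurableSpace E] [BorelSpace E]

theorem integrable_inner_stdGaussian (y : E) :
    Integrable (fun g => inner ℝ y g) (stdGaussian E) :=
  (innerSL ℝ y).integrable_comp IsGaussian.integrable_id

theorem integral_abs_inner_stdGaussian (y : E) :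
    ∫ g, |inner ℝ y g| ∂(stdGaussian E) = Real.sqrt (2 / Real.pi) * ‖y‖ := by
  have hmap : (stdGaussian E).map (innerSL ℝ y) = (gaussianReal 0 1).map (fun x => ‖y‖ * x) := by
    rw [IsGaussian.map_eq_gaussianReal, integral_strongDual_stdGaussian,
      variance_dual_stdGaussian, gaussianReal_map_const_mul, innerSL_apply_norm]
    congr 1
    · simp
    · ext
      simp
  have h := integral_map (μ := stdGaussian E) (φ := innerSL ℝ y) (by fun_prop)
    (f := fun t : ℝ => |t|) (by fun_prop)
  simp only [innerSL_apply_apply] at h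
  rw [← h, hmap, integral_map (by fun_prop) (by fun_prop)]
  simp_rw [abs_mul, abs_norm]
  rw [integral_const_mul, integral_abs_gaussianReal_zero_one, mul_comm]

theorem lintegral_enorm_inner_stdGaussian (y : E) :
    ∫⁻ g, ‖inner ℝ y g‖ₑ ∂(stdGaussian E) = ENNReal.ofReal (Real.sqrt (2 / Real.pi)) * ‖y‖ₑ := by
  rw [← ofReal_integral_norm_eq_lintegral_enorm (integrable_inner_stdGaussian y)]
  simp_rw [Real.norm_eq_abs]
  rw [integral_abs_inner_stdGaussian, ENNReal.ofReal_mul (by positivity), ofReal_norm]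

theorem integral_eq_zero_of_odd_stdGaussian {F : Type*} [NormedAddCommGroup F] [NormedSpace ℝ F]
    {h : E → F} (hodd : ∀ y, h (-y) = -h y) : ∫ y, h y ∂(stdGaussian E) = 0 := by
  have h1 : ∫ y, h (-y) ∂(stdGaussian E) = ∫ y, h y ∂(stdGaussian E) := by
    have h2 : MeasurePreserving (LinearIsometryEquiv.neg ℝ (E := E))
        (stdGaussian E) (stdGaussian E) :=
      ⟨(LinearIsometryEquiv.neg ℝ (E := E)).continuous.measurable, stdGaussian_map _⟩
    exact h2.integral_comp
      (LinearIsometryEquiv.neg ℝ (E := E)).toHomeomorph.measurableEmbedding h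
  simp_rw [hodd] at h1
  rw [integral_neg] at h1
  have h3 : (2 : ℝ) • ∫ y, h y ∂(stdGaussian E) = 0 := by
    rw [two_smul]
    nth_rewrite 1 [← h1]
    exact neg_add_cancel _
  exact (smul_eq_zero.1 h3).resolve_left two_ne_zero

theorem measurable_coe_sign : Measurable fun t : ℝ => ((SignType.sign t : SignType) : ℝ) := by
  have h : (fun t : ℝ => ((SignType.sign t : SignType) : ℝ)) = Real.sign := by
    ext t
    rcases lt_trichotomy t 0 with h | h | h <;> simp [h, Real.sign_of_neg, Real.sign_of_pos]
  rw [h]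
  unfold Real.sign
  exact Measurable.ite measurableSet_Iio measurable_const
    (Measurable.ite measurableSet_Ioi measurable_const measurable_const)

theorem abs_coe_sign_le_one (t : ℝ) : |((SignType.sign t : SignType) : ℝ)| ≤ 1 := by
  rcases lt_trichotomy t 0 with h | h | h <;> simp [h]

theorem measurable_coe_sign_inner (x : E) :
    Measurable fun y : E => ((SignType.sign (inner ℝ y x) : SignType) : ℝ) :=
  measurable_coe_sign.comp (by fun_prop)

theorem integrable_sign_inner_smul_stdGaussian (x : E) :
    Integrable (fun y => ((SignType.sign (inner ℝ y x) : SignType) : ℝ) • y) (stdGaussian E) := by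
  refine IsGaussian.integrable_id.mono
    ((measurable_coe_sign_inner x).smul measurable_id).aestronglyMeasurable
    (Filter.Eventually.of_forall fun y => ?_)
  rw [norm_smul]
  exact mul_le_of_le_one_left (norm_nonneg _) (abs_coe_sign_le_one _)

/-- The reflection fixing the line of `x` preserves both the Gaussian and the sign, so it fixes the
integral, which is therefore a multiple of `x`. Pairing with `x` finds the multiple as an absolute
moment. The factor `‖x‖` avoids normalising `x` and lets `x = 0` in. -/
theorem integral_sign_inner_smul_stdGaussian (x : E) :
    ‖x‖ • ∫ y, ((SignType.sign (inner ℝ y x) : SignType) : ℝ) • y ∂(stdGaussian E) =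
      Real.sqrt (2 / Real.pi) • x := by
  rcases eq_or_ne x 0 with rfl | hx
  · simp
  set I := ∫ y, ((SignType.sign (inner ℝ y x) : SignType) : ℝ) • y ∂(stdGaussian E) with hI
  have hint := integrable_sign_inner_smul_stdGaussian x
  set R := (Submodule.span ℝ {x}).reflection with hR
  have hRx : R x = x :=
    Submodule.reflection_mem_subspace_eq_self (Submodule.mem_span_singleton_self x)
  have hinner : ∀ y, inner ℝ (R y) x = inner ℝ y x := fun y => by
    conv_lhs => rw [← hRx]
    exact R.inner_map_map y x
  have hRI : R I = I := by
    have h1 : R I = ∫ y, R (((SignType.sign (inner ℝ y x) : SignType) : ℝ) • y)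
        ∂(stdGaussian E) :=
      (R.toContinuousLinearEquiv.toContinuousLinearMap.integral_comp_comm hint).symm
    have h2 : MeasurePreserving R (stdGaussian E) (stdGaussian E) :=
      ⟨R.continuous.measurable, stdGaussian_map R⟩
    rw [h1, hI, ← h2.integral_comp R.toHomeomorph.measurableEmbedding]
    refine integral_congr_ae (Filter.Eventually.of_forall fun y => ?_)
    simp only [map_smul, hinner]
    rw [hR, Submodule.reflection_reflection]
  obtain ⟨a, ha⟩ := Submodule.mem_span_singleton.1 ((Submodule.reflection_eq_self_iff I).1 hRI)
  have h3 : inner ℝ x I = Real.sqrt (2 / Real.pi) * ‖x‖ := by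
    rw [hI, ← integral_inner hint, ← integral_abs_inner_stdGaussian]
    refine integral_congr_ae (Filter.Eventually.of_forall fun y => ?_)
    simp only [inner_smul_right]
    rw [real_inner_comm]
    exact sign_mul_self _
  rw [← ha, inner_smul_right, real_inner_self_eq_norm_sq] at h3
  have hx' : ‖x‖ ≠ 0 := norm_ne_zero_iff.2 hx
  rw [← ha, smul_smul]
  congr 1
  apply mul_right_cancel₀ hx'
  rw [← h3]
  ring

/-! ### Upper bound: the extremal measure -/

variable (E) in
/-- The centred Gaussian measure of mass `2` and covariance `(π / 2) • 1`; it generates a metronoid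
containing the unit ball at minimal cost. -/
noncomputable def optimalGaussian : Measure E :=
  (2 : ℝ≥0∞) • (stdGaussian E).map (fun g => Real.sqrt (Real.pi / 2) • g)

theorem integral_optimalGaussian {F : Type*} [NormedAddCommGroup F] [NormedSpace ℝ F] (h : E → F) :
    ∫ y, h y ∂(optimalGaussian E) =
      (2 : ℝ) • ∫ g, h (Real.sqrt (Real.pi / 2) • g) ∂(stdGaussian E) := by
  have hc : Real.sqrt (Real.pi / 2) ≠ 0 := by positivity
  rw [optimalGaussian, integral_smul_measure,
    (measurableEmbedding_const_smul₀ hc).integral_map]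
  simp

theorem closedBall_subset_metronoid_optimalGaussian :
    Metric.closedBall (0 : E) 1 ⊆ metronoid (optimalGaussian E) := by
  intro x hx
  have hx1 : ‖x‖ ≤ 1 := by simpa using hx
  have hc : 0 < Real.sqrt (Real.pi / 2) := by positivity
  set c := Real.sqrt (Real.pi / 2) with hcdef
  set s : E → ℝ := fun y => ((SignType.sign (inner ℝ y x) : SignType) : ℝ) with hs
  have hsm : Measurable s := measurable_coe_sign_inner x
  have hs1 : ∀ y, |s y| ≤ 1 := fun y => abs_coe_sign_le_one _
  have hsc : ∀ y, s (c • y) = s y := fun y => by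
    simp only [hs, inner_smul_left, sign_mul]
    simp [hc]
  have hsint : Integrable s (stdGaussian E) :=
    Integrable.of_bound hsm.aestronglyMeasurable 1 (Filter.Eventually.of_forall hs1)
  have hssint : Integrable (fun y => s y • y) (stdGaussian E) :=
    integrable_sign_inner_smul_stdGaussian x
  have hid : Integrable (fun y : E => y) (stdGaussian E) := IsGaussian.integrable_id
  have hrw : ∀ g : E, ((1 + ‖x‖ * s g) / 2) • c • g = (c / 2) • g + (c / 2 * ‖x‖) • s g • g := by
    intro g
    module
  -- This mixes the constant `1/2` with the half-space indicator `(1 + s) / 2`. As `s` is odd, only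
  -- the constant contributes to the mass and only `s` to the barycentre.
  refine ⟨fun y => (1 + ‖x‖ * s y) / 2, ?_, fun y => ?_, ?_, ?_, ?_⟩
  · exact ((hsm.const_mul _).const_add _).div_const _
  · have h1 : |‖x‖ * s y| ≤ 1 := by
      rw [abs_mul, abs_norm]
      exact mul_le_one₀ hx1 (abs_nonneg _) (hs1 y)
    have h2 := abs_le.1 h1
    constructor <;> linarith
  · rw [integral_optimalGaussian]
    simp_rw [← hcdef, hsc]
    rw [integral_div, integral_add (integrable_const _) (hsint.const_mul _), integral_const_mul,
      integral_eq_zero_of_odd_stdGaussian (h := s)]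
    · simp
    · intro y
      simp only [hs, inner_neg_left, Left.sign_neg, SignType.coe_neg]
  · refine Integrable.smul_measure ?_ (by simp)
    rw [(measurableEmbedding_const_smul₀ hc.ne').integrable_map_iff]
    refine ((hid.smul (c / 2)).add (hssint.smul (c / 2 * ‖x‖))).congr
      (Filter.Eventually.of_forall fun g => ?_)
    simp only [Function.comp_apply, Pi.add_apply, Pi.smul_apply, hsc, hrw]
  · rw [integral_optimalGaussian]
    simp_rw [← hcdef, hsc, hrw]
    have hadd : ∫ g : E, (c / 2) • g + (c / 2 * ‖x‖) • s g • g ∂(stdGaussian E) =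
        ∫ g : E, (c / 2) • g ∂(stdGaussian E) +
          ∫ g : E, (c / 2 * ‖x‖) • s g • g ∂(stdGaussian E) :=
      integral_add (hid.smul _) (hssint.smul _)
    rw [hadd, integral_smul, integral_smul,
      integral_id_stdGaussian, smul_zero, zero_add, mul_smul,
      integral_sign_inner_smul_stdGaussian x, smul_smul, smul_smul]
    have h1 : c * Real.sqrt (2 / Real.pi) = 1 := by
      rw [hcdef, ← Real.sqrt_mul (by positivity)]
      rw [Real.sqrt_eq_one]
      field_simp
    rw [show 2 * (c / 2) * Real.sqrt (2 / Real.pi) = 1 by linarith, one_smul]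

theorem lintegral_enorm_optimalGaussian :
    ∫⁻ y, ‖y‖ₑ ∂(optimalGaussian E) =
      ENNReal.ofReal (Real.sqrt (2 * Real.pi) * ∫ g : E, ‖g‖ ∂(stdGaussian E)) := by
  rw [optimalGaussian, lintegral_smul_measure, lintegral_map (by fun_prop) (by fun_prop)]
  simp_rw [enorm_smul]
  rw [lintegral_const_mul _ (by fun_prop), ENNReal.ofReal_mul (by positivity),
    ofReal_integral_norm_eq_lintegral_enorm IsGaussian.integrable_fun_id, smul_eq_mul, ← mul_assoc]
  congr 1
  rw [Real.enorm_of_nonneg (by positivity), ← ENNReal.ofReal_ofNat 2,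
    ← ENNReal.ofReal_mul (by norm_num)]
  congr 1
  rw [← Real.sqrt_sq (show (0 : ℝ) ≤ 2 by norm_num), ← Real.sqrt_mul (by norm_num)]
  congr 1
  norm_num
  ring

end

/-! ### Lower bound and exact formula -/

/-- The points `±g/‖g‖` come from weights `f₁`, `f₂`. Pairing their difference with `g` gives `2‖g‖
= ∫ (f₁ - f₂) ⟪g, y⟫ dμ`, and `|f₁ - f₂| ≤ 1`. -/
theorem two_mul_enorm_le_lintegral_of_closedBall_subset_metronoid {E : Type*}
    [NormedAddCommGroup E] [InnerProductSpace ℝ E] [CompleteSpace E] [MeasurableSpace E]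
    {μ : Measure E} (hμ : Metric.closedBall (0 : E) 1 ⊆ metronoid μ) (g : E) :
    2 * ‖g‖ₑ ≤ ∫⁻ y, ‖inner ℝ g y‖ₑ ∂μ := by
  have key : ∀ x ∈ metronoid μ, ∃ f : E → ℝ, (∀ y, 0 ≤ f y ∧ f y ≤ 1) ∧
      Integrable (fun y => f y * inner ℝ g y) μ ∧ ∫ y, f y * inner ℝ g y ∂μ = inner ℝ g x := by
    rintro x ⟨f, -, hf, -, hint, rfl⟩
    refine ⟨f, hf, ?_, ?_⟩
    · simpa only [inner_smul_right] using hint.const_inner (𝕜 := ℝ) g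
    · rw [← integral_inner hint]
      simp only [inner_smul_right]
  -- With `0⁻¹ = 0`, the case `g = 0` needs no separate treatment here.
  have hmem : ∀ c : ℝ, |c| = 1 → c • ‖g‖⁻¹ • g ∈ Metric.closedBall (0 : E) 1 := by
    intro c hc
    rw [mem_closedBall_zero_iff, norm_smul, norm_smul, Real.norm_eq_abs, hc, one_mul, norm_inv,
      norm_norm]
    exact inv_mul_le_one
  obtain ⟨f₁, hf₁, hi₁, he₁⟩ := key _ (hμ (hmem 1 (by simp)))
  obtain ⟨f₂, hf₂, hi₂, he₂⟩ := key _ (hμ (hmem (-1) (by simp)))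
  have hg : ‖g‖⁻¹ * ‖g‖ ^ 2 = ‖g‖ := by
    rcases eq_or_ne ‖g‖ 0 with h | h
    · simp [h]
    · field_simp
  simp only [inner_smul_right, real_inner_self_eq_norm_sq, hg] at he₁ he₂
  have hsum : ∫ y, (f₁ y * inner ℝ g y - f₂ y * inner ℝ g y) ∂μ = 2 * ‖g‖ := by
    rw [integral_sub hi₁ hi₂, he₁, he₂]
    ring
  calc 2 * ‖g‖ₑ = ‖∫ y, (f₁ y * inner ℝ g y - f₂ y * inner ℝ g y) ∂μ‖ₑ := by
        rw [hsum, enorm_mul, enorm_norm]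
        congr 1
        rw [Real.enorm_of_nonneg (by norm_num)]
        simp
    _ ≤ ∫⁻ y, ‖f₁ y * inner ℝ g y - f₂ y * inner ℝ g y‖ₑ ∂μ := enorm_integral_le_lintegral_enorm _
    _ ≤ ∫⁻ y, ‖inner ℝ g y‖ₑ ∂μ := by
        refine lintegral_mono fun y => ?_
        rw [enorm_le_iff_norm_le, ← sub_mul, norm_mul]
        refine mul_le_of_le_one_left (norm_nonneg _) ?_
        rw [Real.norm_eq_abs, abs_le]
        constructor <;> linarith [(hf₁ y).1, (hf₁ y).2, (hf₂ y).1, (hf₂ y).2]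

section

variable {E : Type*} [NormedAddCommGroup E] [InnerProductSpace ℝ E] [FiniteDimensional ℝ E]
  [MeasurableSpace E] [BorelSpace E]

/-- Averaging `|⟪y, g⟫|` over a standard Gaussian vector `g`; the measure `μ` need not be s-finite,
so Tonelli's theorem is applied to the finite measure with density `‖y‖`. -/
theorem lintegral_lintegral_enorm_inner_stdGaussian {μ : Measure E} (hμ : ∫⁻ y, ‖y‖ₑ ∂μ ≠ ∞) :
    ∫⁻ g, ∫⁻ y, ‖inner ℝ g y‖ₑ ∂μ ∂(stdGaussian E) =
      ENNReal.ofReal (Real.sqrt (2 / Real.pi)) * ∫⁻ y, ‖y‖ₑ ∂μ := by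
  have hfin : IsFiniteMeasure (μ.withDensity fun y => ‖y‖ₑ) := isFiniteMeasure_withDensity hμ
  -- The factor `‖y‖` becomes the density, leaving a function of the direction of `y`. At the origin
  -- the direction is undefined, but the weight vanishes.
  have hpt : ∀ g y : E, ‖inner ℝ g y‖ₑ = ‖y‖ₑ * ‖inner ℝ g (‖y‖⁻¹ • y)‖ₑ := by
    intro g y
    rcases eq_or_ne y 0 with rfl | hy
    · simp
    · rw [inner_smul_right, ← enorm_norm y, ← enorm_mul, ← mul_assoc,
        mul_inv_cancel₀ (norm_ne_zero_iff.2 hy), one_mul]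
  have hmeas : Measurable fun p : E × E => ‖inner ℝ p.1 (‖p.2‖⁻¹ • p.2)‖ₑ := by fun_prop
  have hd : ∀ F : E → ℝ≥0∞, Measurable F →
      ∫⁻ y, F y ∂(μ.withDensity fun y => ‖y‖ₑ) = ∫⁻ y, ‖y‖ₑ * F y ∂μ := fun F hF =>
    lintegral_withDensity_eq_lintegral_mul _ measurable_enorm hF
  calc ∫⁻ g, ∫⁻ y, ‖inner ℝ g y‖ₑ ∂μ ∂(stdGaussian E)
      = ∫⁻ g, ∫⁻ y, ‖inner ℝ g (‖y‖⁻¹ • y)‖ₑ ∂(μ.withDensity fun y => ‖y‖ₑ)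
          ∂(stdGaussian E) := by
        refine lintegral_congr fun g => ?_
        rw [hd _ (by fun_prop)]
        exact lintegral_congr fun y => hpt g y
    _ = ∫⁻ y, ∫⁻ g, ‖inner ℝ g (‖y‖⁻¹ • y)‖ₑ ∂(stdGaussian E)
          ∂(μ.withDensity fun y => ‖y‖ₑ) := lintegral_lintegral_swap hmeas.aemeasurable
    _ = ∫⁻ y, ENNReal.ofReal (Real.sqrt (2 / Real.pi)) * ‖‖y‖⁻¹ • y‖ₑ
          ∂(μ.withDensity fun y => ‖y‖ₑ) := by
        refine lintegral_congr fun y => ?_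
        rw [← lintegral_enorm_inner_stdGaussian]
        exact lintegral_congr fun g => by rw [real_inner_comm]
    _ = ∫⁻ y, ENNReal.ofReal (Real.sqrt (2 / Real.pi)) * ‖y‖ₑ ∂μ := by
        rw [hd _ (by fun_prop)]
        refine lintegral_congr fun y => ?_
        rcases eq_or_ne y 0 with rfl | hy
        · simp
        · have h1 : ‖‖y‖⁻¹ • y‖ₑ = 1 := by
            rw [← ofReal_norm, norm_smul, norm_inv, norm_norm,
              inv_mul_cancel₀ (norm_ne_zero_iff.2 hy), ENNReal.ofReal_one]
          rw [h1, mul_one, mul_comm]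
    _ = _ := lintegral_const_mul _ measurable_enorm

theorem fracVertexIndex_closedBall_eq :
    fracVertexIndex (Metric.closedBall (0 : E) 1) =
      ENNReal.ofReal (Real.sqrt (2 * Real.pi) * ∫ g : E, ‖g‖ ∂(stdGaussian E)) := by
  have hgauge : ∀ y : E, ENNReal.ofReal (gauge (Metric.closedBall (0 : E) 1) y) = ‖y‖ₑ := by
    intro y
    rw [gauge_closedBall zero_le_one, div_one, ofReal_norm]
  simp only [fracVertexIndex, hgauge]
  apply le_antisymm
  · exact (iInf₂_le (optimalGaussian E) closedBall_subset_metronoid_optimalGaussian).trans_eq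
      lintegral_enorm_optimalGaussian
  · refine le_iInf₂ fun μ hμ => ?_
    by_cases hfin : ∫⁻ y, ‖y‖ₑ ∂μ = ∞
    · rw [hfin]
      exact le_top
    have h1 : 2 * ∫⁻ g : E, ‖g‖ₑ ∂(stdGaussian E) ≤
        ENNReal.ofReal (Real.sqrt (2 / Real.pi)) * ∫⁻ y, ‖y‖ₑ ∂μ := by
      rw [← lintegral_lintegral_enorm_inner_stdGaussian hfin,
        ← lintegral_const_mul _ measurable_enorm]
      exact lintegral_mono fun g =>
        two_mul_enorm_le_lintegral_of_closedBall_subset_metronoid hμ g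
    have h2 : Real.sqrt (Real.pi / 2) * Real.sqrt (2 / Real.pi) = 1 := by
      rw [← Real.sqrt_mul (by positivity), Real.sqrt_eq_one]
      field_simp
    have h3 : Real.sqrt (2 * Real.pi) = Real.sqrt (Real.pi / 2) * 2 := by
      rw [← Real.sqrt_sq (show (0 : ℝ) ≤ 2 by norm_num), ← Real.sqrt_mul (by positivity)]
      congr 1
      norm_num
      ring
    calc ENNReal.ofReal (Real.sqrt (2 * Real.pi) * ∫ g : E, ‖g‖ ∂(stdGaussian E))
        = ENNReal.ofReal (Real.sqrt (Real.pi / 2)) *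
            (2 * ∫⁻ g : E, ‖g‖ₑ ∂(stdGaussian E)) := by
          rw [h3, mul_assoc, ENNReal.ofReal_mul (by positivity), ENNReal.ofReal_mul (by norm_num),
            ofReal_integral_norm_eq_lintegral_enorm IsGaussian.integrable_fun_id,
            ENNReal.ofReal_ofNat]
      _ ≤ ENNReal.ofReal (Real.sqrt (Real.pi / 2)) *
            (ENNReal.ofReal (Real.sqrt (2 / Real.pi)) * ∫⁻ y, ‖y‖ₑ ∂μ) := by gcongr
      _ = ∫⁻ y, ‖y‖ₑ ∂μ := by
          rw [← mul_assoc, ← ENNReal.ofReal_mul (by positivity), h2, ENNReal.ofReal_one, one_mul]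

end

/-! ### Moments and asymptotics of the Gaussian norm -/

section

variable {ι : Type*} [Fintype ι]

theorem memLp_sq_gaussianReal : MemLp (fun x : ℝ => x ^ 2) 2 (gaussianReal 0 1) := by
  refine (memLp_two_iff_integrable_sq (by fun_prop)).2 ?_
  have h := (memLp_id_gaussianReal (μ := 0) (v := 1) 4).integrable_norm_rpow
    (by norm_num) (by norm_num)
  refine h.congr (Filter.Eventually.of_forall fun x => ?_)
  simp only [id, ENNReal.coe_ofNat, ENNReal.toReal_ofNat, Real.norm_eq_abs]
  rw [show (4 : ℝ) = ((4 : ℕ) : ℝ) by norm_num, Real.rpow_natCast, ← abs_pow,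
    abs_of_nonneg (by positivity)]
  ring

theorem integral_sq_gaussianReal : ∫ x, x ^ 2 ∂(gaussianReal 0 1) = 1 := by
  have h := variance_fun_id_gaussianReal (μ := 0) (v := 1)
  rw [variance_of_integral_eq_zero (by fun_prop) (by simp)] at h
  simpa using h

/-- `‖g‖ ^ 2` is a sum of independent squares of mean 1, so variances add. The variance of one
square stays unevaluated: only its independence of the dimension matters. -/
theorem norm_sq_moments_stdGaussian :
    MemLp (fun g : EuclideanSpace ℝ ι => ‖g‖ ^ 2) 2 (stdGaussian (EuclideanSpace ℝ ι)) ∧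
    ∫ g : EuclideanSpace ℝ ι, ‖g‖ ^ 2 ∂(stdGaussian (EuclideanSpace ℝ ι)) = Fintype.card ι ∧
    ∫ g : EuclideanSpace ℝ ι, ‖g‖ ^ 4 ∂(stdGaussian (EuclideanSpace ℝ ι)) =
      Fintype.card ι ^ 2 + Fintype.card ι * Var[fun x : ℝ => x ^ 2; gaussianReal 0 1] := by
  set P : Measure (ι → ℝ) := Measure.pi fun _ => gaussianReal 0 1 with hP
  have hmap : stdGaussian (EuclideanSpace ℝ ι) = P.map (WithLp.toLp 2) :=
    map_pi_eq_stdGaussian.symm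
  have hmeas : Measurable (WithLp.toLp 2 : (ι → ℝ) → EuclideanSpace ℝ ι) := by fun_prop
  have hnorm : ∀ x : ι → ℝ, ‖(WithLp.toLp 2 x : EuclideanSpace ℝ ι)‖ ^ 2 = ∑ i, x i ^ 2 := by
    intro x
    rw [EuclideanSpace.real_norm_sq_eq]
  have hcoord : ∀ i, MemLp (fun x : ι → ℝ => x i ^ 2) 2 P := fun i =>
    memLp_sq_gaussianReal.comp_measurePreserving
      (measurePreserving_eval (fun _ : ι => gaussianReal 0 1) i)
  have hsum : MemLp (fun x : ι → ℝ => ∑ i, x i ^ 2) 2 P :=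
    memLp_finsetSum _ fun i _ => hcoord i
  have hmean : ∫ x, ∑ i, x i ^ 2 ∂P = Fintype.card ι := by
    rw [integral_finsetSum _ fun i _ => (hcoord i).integrable one_le_two]
    have : ∀ i, ∫ x, x i ^ 2 ∂P = 1 := fun i => by
      rw [← integral_sq_gaussianReal]
      exact integral_comp_eval (μ := fun _ : ι => gaussianReal 0 1) (i := i)
        (f := fun t : ℝ => t ^ 2) (by fun_prop)
    simp [this]
  have hvar : Var[fun x : ι → ℝ => ∑ i, x i ^ 2; P] =
      Fintype.card ι * Var[fun x : ℝ => x ^ 2; gaussianReal 0 1] := by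
    have h := variance_sum_pi (μ := fun _ : ι => gaussianReal 0 1)
      (X := fun _ (t : ℝ) => t ^ 2) (fun _ => memLp_sq_gaussianReal)
    rw [Finset.sum_const, Finset.card_univ, nsmul_eq_mul] at h
    rw [← h]
    congr 1
    ext x
    simp
  have hvar' := variance_eq_sub hsum
  refine ⟨?_, ?_, ?_⟩
  · rw [hmap, memLp_map_measure_iff (by fun_prop) hmeas.aemeasurable]
    refine hsum.congr_norm (by fun_prop) (Filter.Eventually.of_forall fun x => ?_)
    simp only [Function.comp_apply, hnorm]
  · rw [hmap, integral_map hmeas.aemeasurable (by fun_prop)]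
    simp_rw [hnorm, hmean]
  · rw [hmap, integral_map hmeas.aemeasurable (by fun_prop)]
    have h4 : ∀ x : ι → ℝ, ‖(WithLp.toLp 2 x : EuclideanSpace ℝ ι)‖ ^ 4 =
        (∑ i, x i ^ 2) ^ 2 := fun x => by rw [← hnorm x]; ring
    simp_rw [h4]
    rw [hvar, hmean] at hvar'
    simp only [Pi.pow_apply] at hvar'
    linarith

/-- Integrate the tangent bound `t ≤ t²/(2a) + a/2` at `a = √n`. -/
theorem integral_norm_stdGaussian_le [Nonempty ι] :
    ∫ g : EuclideanSpace ℝ ι, ‖g‖ ∂(stdGaussian (EuclideanSpace ℝ ι)) ≤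
      Real.sqrt (Fintype.card ι) := by
  obtain ⟨hL, h2, -⟩ := norm_sq_moments_stdGaussian (ι := ι)
  have hn : (0 : ℝ) < Fintype.card ι := by exact_mod_cast Fintype.card_pos
  set a := Real.sqrt (Fintype.card ι) with ha
  have ha0 : 0 < a := Real.sqrt_pos.2 hn
  have ha2 : a ^ 2 = Fintype.card ι := Real.sq_sqrt hn.le
  have hi2 := hL.integrable one_le_two
  calc ∫ g : EuclideanSpace ℝ ι, ‖g‖ ∂(stdGaussian (EuclideanSpace ℝ ι))
      ≤ ∫ g : EuclideanSpace ℝ ι, ((2 * a)⁻¹ * ‖g‖ ^ 2 + a / 2)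
          ∂(stdGaussian (EuclideanSpace ℝ ι)) := by
        refine integral_mono IsGaussian.integrable_fun_id.norm
          ((hi2.const_mul _).add (integrable_const _)) fun g => ?_
        have : (2 * a)⁻¹ * ‖g‖ ^ 2 + a / 2 - ‖g‖ = (2 * a)⁻¹ * (‖g‖ - a) ^ 2 := by
          field_simp
          ring
        have : 0 ≤ (2 * a)⁻¹ * (‖g‖ - a) ^ 2 := by positivity
        show ‖g‖ ≤ (2 * a)⁻¹ * ‖g‖ ^ 2 + a / 2
        linarith
    _ = a := by
        rw [integral_add (hi2.const_mul _) (integrable_const _), integral_const_mul, h2, ← ha2]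
        simp
        field_simp
        ring

/-- The even quartic `3t²/(2a) - t⁴/(2a³)` touches `t` from below at `a = √n`: the gap is `t(t -
a)²(t + 2a)/(2a³)`. Its mean involves only the two known moments. -/
theorem le_integral_norm_stdGaussian [Nonempty ι] :
    Real.sqrt (Fintype.card ι) *
        (1 - Var[fun x : ℝ => x ^ 2; gaussianReal 0 1] / 2 / Fintype.card ι) ≤
      ∫ g : EuclideanSpace ℝ ι, ‖g‖ ∂(stdGaussian (EuclideanSpace ℝ ι)) := by
  obtain ⟨hL, h2, h4⟩ := norm_sq_moments_stdGaussian (ι := ι)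
  have hn : (0 : ℝ) < Fintype.card ι := by exact_mod_cast Fintype.card_pos
  set a := Real.sqrt (Fintype.card ι) with ha
  set v := Var[fun x : ℝ => x ^ 2; gaussianReal 0 1]
  have ha0 : 0 < a := Real.sqrt_pos.2 hn
  have ha2 : a ^ 2 = Fintype.card ι := Real.sq_sqrt hn.le
  have hi2 := hL.integrable one_le_two
  have hi4 : Integrable (fun g : EuclideanSpace ℝ ι => ‖g‖ ^ 4)
      (stdGaussian (EuclideanSpace ℝ ι)) :=
    hL.integrable_sq.congr (Filter.Eventually.of_forall fun g => by simp only; ring)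
  calc a * (1 - v / 2 / Fintype.card ι)
      = ∫ g : EuclideanSpace ℝ ι, (3 / (2 * a) * ‖g‖ ^ 2 - (2 * a ^ 3)⁻¹ * ‖g‖ ^ 4)
          ∂(stdGaussian (EuclideanSpace ℝ ι)) := by
        rw [integral_sub (hi2.const_mul _) (hi4.const_mul _), integral_const_mul,
          integral_const_mul, h2, h4, ← ha2]
        field_simp
        ring
    _ ≤ ∫ g : EuclideanSpace ℝ ι, ‖g‖ ∂(stdGaussian (EuclideanSpace ℝ ι)) := by
        refine integral_mono ((hi2.const_mul _).sub (hi4.const_mul _))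
          IsGaussian.integrable_fun_id.norm fun g => ?_
        have h1 : ‖g‖ - (3 / (2 * a) * ‖g‖ ^ 2 - (2 * a ^ 3)⁻¹ * ‖g‖ ^ 4) =
            (2 * a ^ 3)⁻¹ * (‖g‖ * ((‖g‖ - a) ^ 2 * (‖g‖ + 2 * a))) := by
          field_simp
          ring
        have : 0 ≤ (2 * a ^ 3)⁻¹ * (‖g‖ * ((‖g‖ - a) ^ 2 * (‖g‖ + 2 * a))) := by positivity
        show 3 / (2 * a) * ‖g‖ ^ 2 - (2 * a ^ 3)⁻¹ * ‖g‖ ^ 4 ≤ ‖g‖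
        linarith

end

theorem proposition4p2 :
    ∃ ε : ℕ → ℝ, Filter.Tendsto ε Filter.atTop (nhds 0) ∧
      ∀ n : ℕ, 1 ≤ n →
        fracVertexIndex (Metric.closedBall (0 : EuclideanSpace ℝ (Fin n)) 1) =
          ENNReal.ofReal (Real.sqrt (2 * Real.pi * (n : ℝ)) * (1 + ε n)) := by
  set m : ℕ → ℝ := fun n => ∫ g : EuclideanSpace ℝ (Fin n), ‖g‖
    ∂(stdGaussian (EuclideanSpace ℝ (Fin n))) with hm
  -- The exact formula forces this choice for `n ≥ 1`; the moment bounds squeeze it between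
  -- `-v/(2n)` and `0`.
  refine ⟨fun n => m n / Real.sqrt n - 1, ?_, fun n hn => ?_⟩
  · set v := Var[fun x : ℝ => x ^ 2; gaussianReal 0 1] with hv
    refine tendsto_of_tendsto_of_tendsto_of_le_of_le' (g := fun n : ℕ => -(v / 2 / (n : ℝ)))
      (h := fun _ => (0 : ℝ)) ?_ tendsto_const_nhds ?_ ?_
    · simpa using (tendsto_const_div_atTop_nhds_zero_nat (v / 2)).neg
    · filter_upwards [Filter.eventually_ge_atTop 1] with n hn
      have : NeZero n := ⟨by omega⟩
      have hs : 0 < Real.sqrt n := Real.sqrt_pos.2 (by exact_mod_cast hn)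
      have h := le_integral_norm_stdGaussian (ι := Fin n)
      rw [Fintype.card_fin, mul_comm, ← le_div_iff₀ hs] at h
      linarith
    · filter_upwards [Filter.eventually_ge_atTop 1] with n hn
      have : NeZero n := ⟨by omega⟩
      have hs : 0 < Real.sqrt n := Real.sqrt_pos.2 (by exact_mod_cast hn)
      have h := integral_norm_stdGaussian_le (ι := Fin n)
      rw [Fintype.card_fin, ← div_le_one hs] at h
      linarith
  · have hs : 0 < Real.sqrt n := Real.sqrt_pos.2 (by exact_mod_cast hn)
    rw [fracVertexIndex_closedBall_eq, Real.sqrt_mul (by positivity) (n : ℝ)]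
    congr 1
    change Real.sqrt (2 * Real.pi) * m n = _
    field_simp
    ring
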